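/- For a nonnegative integer $n$ let $Q_n$ be the hypercube of dimension $n$, i.e. the graph whose vertices are the binary sequences of length $n$ and whose edges are the pairs of sequences that differ in exactly one position. For graphs $G,T$ let $N(G,T)$ be the number of (not necessarily induced) subgraphs of $G$ that are isomorphic to $T$; let $\mathrm{ex}(G,T,H)$ be the maximum of $N(G',T)$ over all subgraphs $G'$ of $G$ that contain no subgraph isomorphic to $H$; and let $\mathbf d(G,T,H)=\mathrm{ex}(G,T,H)/N(G,T)$. There is an absolute constant $\alpha>0$ such that for all integers $k$ and $\ell$ with $2\le \ell<k$ and all sufficiently large integers $n$ (how large may depend on $k$ and $\ell$), \[ \max\left\{1-\frac{\ell}{k},\; 1-\frac{4\binom{\ell+2}{3}}{k(k+2)}\right\}\;\le\;\mathbf d(Q_n,Q_\ell,Q_k)\;\le\;\min\left\{1-\frac{\ell\,2^{\ell}}{k\,2^{k}},\; 1-\alpha\,\frac{\log k}{k\,2^{k}}\right\}, \] where $\log$ is the natural logarithm. -/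

import Mathlib

/-- The hypercube `Q_n`: its vertices are the binary sequences of length `n`, and two of them are
adjacent when they differ in exactly one position. -/
def hypercube (n : ℕ) : SimpleGraph (Fin n → Bool) where
  Adj x y := hammingDist x y = 1
  symm := ⟨fun x y h => by rw [hammingDist_comm]; exact h⟩
  loopless := ⟨fun x h => by simp at h⟩

open Classical in
/-- The generalized extremal number `ex(G, T, H)`: the maximum, over all subgraphs `G'` of the
finite graph `G` that contain no subgraph isomorphic to `H`, of the number of subgraphs of `G'`
that are isomorphic to `T`. -/
noncomputable def genExtremal {V W U : Type*} [Fintype V]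
    (G : SimpleGraph V) (T : SimpleGraph W) (H : SimpleGraph U) : ℕ :=
  (Finset.univ.filter (fun G' : G.Subgraph => H.Free G'.coe)).sup
    (fun G' => G'.coe.copyCount T)

/-- The generalized Turán density `d(G, T, H) = ex(G, T, H) / N(G, T)`, where `N(G, T)` is the
number of subgraphs of `G` that are isomorphic to `T`. -/
noncomputable def genTuranDensity {V W U : Type*} [Fintype V]
    (G : SimpleGraph V) (T : SimpleGraph W) (H : SimpleGraph U) : ℝ :=
  (genExtremal G T H : ℝ) / (G.copyCount T : ℝ)

/-
A copy of `Q_l` in `Q_n` is a face of dimension `l`, because an embedded 4-cycle is a 2-face and so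
parallel edges are sent to parallel edges. A subgraph of `Q_n` is therefore free of `Q_k` precisely
when its set `E` of missing edges meets every `k`-face, and the copies of `Q_l` that it lacks are
the `l`-faces that contain a member of `E`: the task is to minimise their number over all such `E`.

Lower bounds on the density. Colour the edges so that every `k`-face contains all colours, while an
`l`-face contains only `t` of them, and let `E` be the colour class that hits the fewest `l`-faces.
Counting the ones modulo `k` gives `k` colours and `t = l`. Counting the ones to the left of the
free coordinate modulo `a` and to its right modulo `b`, where `a + b = k + 1`, gives `a * b` colours
and `t = ∑ (i + 1) * (l - i) = (l + 2).choose 3`, the sum running over `i < l`.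

Upper bounds on the density. A single missing edge in a `k`-face already spoils all `l`-faces of the
`k`-face through that edge. Moreover, the words of the missing edges inside a `(k + 2)`-face
separate its `k + 2` free coordinates, so there are at least `log₃ (k + 2)` of them; averaging turns
this into a density of missing edges, and then of spoilt `l`-faces.
-/

section LinearOrder

open Finset

variable {α : Type*} [LinearOrder α]

lemma bijOn_card_filter_lt (S : Finset α) :
    Set.BijOn (fun i => #{j ∈ S | j < i}) S (range #S) := by
  have hmaps : Set.MapsTo (fun i => #{j ∈ S | j < i}) S (range #S) := fun i hi =>
    mem_coe.2 <| mem_range.2 <| card_lt_card <| filter_ssubset.2 ⟨i, hi, lt_irrefl i⟩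
  have hinj : Set.InjOn (fun i => #{j ∈ S | j < i}) S := by
    refine StrictMonoOn.injOn fun i hi j _ hij => card_lt_card ⟨?_, fun h => ?_⟩
    · exact monotone_filter_right S fun x _ hx => hx.trans hij
    · exact lt_irrefl i (mem_filter.1 (h (mem_filter.2 ⟨hi, hij⟩))).2
  exact ⟨hmaps, hinj, surjOn_of_injOn_of_card_le _ hmaps hinj (card_range _).le⟩

lemma card_filter_lt_add_card_filter_gt {S : Finset α} {i : α} (hi : i ∈ S) :
    #{j ∈ S | j < i} + #{j ∈ S | i < j} + 1 = #S := by
  have hunion : insert i ({j ∈ S | j < i} ∪ {j ∈ S | i < j}) = S := by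
    ext j
    grind
  have hdisj : Disjoint {j ∈ S | j < i} {j ∈ S | i < j} :=
    disjoint_filter.2 fun j _ => lt_asymm
  have hnotMem : i ∉ {j ∈ S | j < i} ∪ {j ∈ S | i < j} := by simp
  rw [← card_union_of_disjoint hdisj, ← card_insert_of_notMem hnotMem, hunion]

lemma sum_range_succ_mul_sub (l : ℕ) :
    ∑ r ∈ range l, (r + 1) * (l - r) = (l + 2).choose 3 := by
  induction l with
  | zero => rfl
  | succ l ih =>
    have hstep : ∀ r ∈ range (l + 1), (r + 1) * (l + 1 - r) = (r + 1) * (l - r) + (r + 1) := by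
      intro r hr
      rw [Nat.sub_add_comm (mem_range_succ_iff.1 hr)]
      ring
    have hgauss : ∑ r ∈ range (l + 1), (r + 1) = (l + 2).choose 2 := by
      rw [Nat.choose_two_right, ← sum_range_id, sum_range_succ' _ (l + 1), add_zero]
    rw [sum_congr rfl hstep, sum_add_distrib, sum_range_succ, ih, hgauss, Nat.sub_self, mul_zero,
      add_zero, Nat.choose_succ_succ' (l + 2) 2, add_comm]

lemma sum_card_filter_lt_succ_mul_card_filter_gt_succ (S : Finset α) :
    ∑ i ∈ S, (#{j ∈ S | j < i} + 1) * (#{j ∈ S | i < j} + 1) = (#S + 2).choose 3 := by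
  obtain ⟨hmaps, hinj, hsurj⟩ := bijOn_card_filter_lt S
  rw [← sum_range_succ_mul_sub]
  refine sum_nbij _ hmaps hinj hsurj fun i hi => ?_
  rw [← card_filter_lt_add_card_filter_gt hi]
  congr 1
  omega

end LinearOrder

lemma exists_subset_natCast_card_eq {α : Type*} {a : ℕ} [NeZero a] {S : Finset α}
    (hS : a ≤ S.card + 1) (z : ZMod a) : ∃ U ⊆ S, (U.card : ZMod a) = z := by
  have hz := ZMod.val_lt z
  obtain ⟨U, hU, hcard⟩ := Finset.exists_subset_card_eq (show z.val ≤ S.card by omega)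
  exact ⟨U, hU, by rw [hcard, ZMod.natCast_zmod_val]⟩

/-- A face of the cube `{0,1}^ι`, recorded as a word over `{0, 1, *}`: the letter `none` marks a
free coordinate, and `some b` a coordinate fixed to `b`. -/
structure CubeFace (ι : Type*) where
  /-- The letter of the word at each coordinate. -/
  letter : ι → Option Bool

namespace CubeFace

open Finset

section Order

variable {ι : Type*} {p q : CubeFace ι}

instance : FunLike (CubeFace ι) ι (Option Bool) where
  coe := letter
  coe_injective := fun ⟨_⟩ ⟨_⟩ h => congrArg mk h

@[ext] lemma ext (h : ∀ i, p i = q i) : p = q := DFunLike.ext p q h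

@[simp] lemma mk_apply (w : ι → Option Bool) (i : ι) : mk w i = w i := rfl

/-- Inclusion of faces. -/
instance : LE (CubeFace ι) := ⟨fun q p => ∀ i, p i = none ∨ q i = p i⟩

lemma le_iff : q ≤ p ↔ ∀ i, p i = none ∨ q i = p i := Iff.rfl

instance : SemilatticeSup (CubeFace ι) where
  le_refl _ _ := Or.inr rfl
  le_trans p q r h h' i := by
    have := h i
    have := h' i
    grind
  le_antisymm p q h h' := by
    ext1 i
    have := h i
    have := h' i
    grind
  sup p q := ⟨fun i => if p i = q i then p i else none⟩
  le_sup_left p q i := by grind [mk_apply]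
  le_sup_right p q i := by grind [mk_apply]
  sup_le p q r h h' i := by
    have := h i
    have := h' i
    grind [mk_apply]

lemma sup_apply (p q : CubeFace ι) (i : ι) :
    (p ⊔ q) i = if p i = q i then p i else none := rfl

instance : OrderTop (CubeFace ι) where
  top := ⟨fun _ => none⟩
  le_top _ _ := Or.inl rfl

@[simp] lemma top_apply (i : ι) : (⊤ : CubeFace ι) i = none := rfl

variable [Fintype ι]

instance : DecidableLE (CubeFace ι) := fun _ _ => decidable_of_iff' _ le_iff

/-- The free coordinates of a face. -/
def free (p : CubeFace ι) : Finset ι := {i | p i = none}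

/-- The coordinates of a face that are fixed to `true`. -/
def ones (p : CubeFace ι) : Finset ι := {i | p i = some true}

@[simp] lemma mem_free {i : ι} : i ∈ p.free ↔ p i = none := by simp [free]

@[simp] lemma mem_ones {i : ι} : i ∈ p.ones ↔ p i = some true := by simp [ones]

@[simp] lemma free_top : (⊤ : CubeFace ι).free = univ := by ext; simp

lemma free_subset_free (h : q ≤ p) : q.free ⊆ p.free := fun i hi => by
  have := h i
  grind [mem_free]

lemma ones_subset_ones (h : q ≤ p) : p.ones ⊆ q.ones := fun i hi => by
  have := h i
  grind [mem_ones]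

lemma disjoint_ones_free (p : CubeFace ι) : Disjoint p.ones p.free :=
  disjoint_left.2 fun i h h' => by simp_all

lemma eq_of_le_of_card_free_le (h : q ≤ p) (hcard : #p.free ≤ #q.free) : q = p := by
  have hfree := eq_of_subset_of_card_le (free_subset_free h) hcard
  ext1 i
  exact (h i).elim (fun hi => by rw [hi, ← mem_free, hfree, mem_free, hi]) id

end Order

section Release

variable {ι : Type*} [DecidableEq ι] {p q : CubeFace ι}

/-- The face obtained from `q` by freeing the coordinates in `T`. -/
def release (q : CubeFace ι) (T : Finset ι) : CubeFace ι :=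
  ⟨fun i => if i ∈ T then none else q i⟩

lemma release_apply (q : CubeFace ι) (T : Finset ι) (i : ι) :
    q.release T i = if i ∈ T then none else q i := rfl

/-- The face of `p` with set of free coordinates `T` on which the remaining free coordinates of
`p` are `true` exactly on `U`. -/
def restrict (p : CubeFace ι) (T U : Finset ι) : CubeFace ι :=
  ⟨fun i => if i ∈ T then none else if p i = none then some (decide (i ∈ U)) else p i⟩

lemma restrict_apply (p : CubeFace ι) (T U : Finset ι) (i : ι) : p.restrict T U i =
    if i ∈ T then none else if p i = none then some (decide (i ∈ U)) else p i := rfl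

lemma le_release (q : CubeFace ι) (T : Finset ι) : q ≤ q.release T := fun i => by
  grind [release_apply]

variable [Fintype ι]

lemma free_release (q : CubeFace ι) (T : Finset ι) : (q.release T).free = T ∪ q.free := by
  ext i
  grind [release_apply, mem_free]

lemma release_le {T : Finset ι} (h : q ≤ p) (hT : T ⊆ p.free) : q.release T ≤ p := fun i => by
  have := h i
  grind [release_apply, mem_free]

lemma release_free_sdiff_free (h : q ≤ p) : q.release (p.free \ q.free) = p := by
  ext1 i
  have := h i
  grind [release_apply, mem_free]

@[simp] lemma free_restrict (p : CubeFace ι) (T U : Finset ι) : (p.restrict T U).free = T := by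
  ext i
  grind [restrict_apply, mem_free]

lemma restrict_le {T : Finset ι} (hT : T ⊆ p.free) (U : Finset ι) : p.restrict T U ≤ p :=
  fun i => by grind [restrict_apply, mem_free]

lemma ones_restrict {T U : Finset ι} (hT : T ⊆ p.free) (hU : U ⊆ p.free \ T) :
    (p.restrict T U).ones = p.ones ∪ U := by
  ext i
  grind [restrict_apply, mem_free, mem_ones]

lemma restrict_free_ones_sdiff_ones (h : q ≤ p) : p.restrict q.free (q.ones \ p.ones) = q := by
  ext1 i
  have := h i
  rcases hq : q i with _ | _ | _ <;> grind [restrict_apply, mem_free, mem_ones]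

lemma ones_sdiff_ones_subset (h : q ≤ p) : q.ones \ p.ones ⊆ p.free \ q.free := fun i hi => by
  have := h i
  grind [mem_free, mem_ones]

end Release

section Counting

variable {ι : Type*} [Fintype ι] [DecidableEq ι] {p q : CubeFace ι}

instance : Fintype (CubeFace ι) := Fintype.ofEquiv (ι → Option Bool) ⟨mk, letter, fun _ => rfl,
  fun _ => rfl⟩

instance : DecidableEq (CubeFace ι) := DFunLike.coe_injective.decidableEq

/-- The faces of dimension `m` of the cube `{0,1}^ι`. -/
def faces (ι : Type*) [Fintype ι] [DecidableEq ι] (m : ℕ) : Finset (CubeFace ι) :=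
  {p | #p.free = m}

@[simp] lemma mem_faces {m : ℕ} : p ∈ faces ι m ↔ #p.free = m := by simp [faces]

lemma card_filter_le_and_le (h : q ≤ p) {m : ℕ} (hm : #q.free ≤ m) :
    #{r ∈ faces ι m | q ≤ r ∧ r ≤ p} = (#p.free - #q.free).choose (m - #q.free) := by
  rw [← card_sdiff_of_subset (free_subset_free h), ← card_powersetCard]
  refine card_nbij' (fun r => r.free \ q.free) q.release ?_ ?_ ?_ ?_
  · intro r hr
    obtain ⟨hr, hqr, hrp⟩ : #r.free = m ∧ q ≤ r ∧ r ≤ p := by simpa using hr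
    rw [mem_coe, mem_powersetCard, card_sdiff_of_subset (free_subset_free hqr), hr]
    exact ⟨sdiff_subset_sdiff (free_subset_free hrp) subset_rfl, rfl⟩
  · intro T hT
    obtain ⟨hT, hcard⟩ := mem_powersetCard.1 hT
    have hfree : #(q.release T).free = m := by
      rw [free_release, card_union_of_disjoint (disjoint_of_subset_left hT sdiff_disjoint), hcard]
      omega
    simpa using ⟨hfree, le_release q T, release_le h (hT.trans sdiff_subset)⟩
  · intro r hr
    exact release_free_sdiff_free (mem_filter.1 hr).2.1
  · intro T hT
    have hdisj := disjoint_of_subset_left (mem_powersetCard.1 hT).1 sdiff_disjoint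
    simp only [free_release, union_sdiff_cancel_right hdisj]

lemma card_filter_ge (q : CubeFace ι) {m : ℕ} (hm : #q.free ≤ m) :
    #{r ∈ faces ι m | q ≤ r} = (Fintype.card ι - #q.free).choose (m - #q.free) := by
  simpa using card_filter_le_and_le (le_top (a := q)) hm

lemma card_filter_le_free_eq {T : Finset ι} (hT : T ⊆ p.free) :
    #{q | q ≤ p ∧ q.free = T} = 2 ^ (#p.free - #T) := by
  rw [← card_sdiff_of_subset hT, ← card_powerset]
  refine card_nbij' (fun q => q.ones \ p.ones) (p.restrict T) ?_ ?_ ?_ ?_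
  · intro q hq
    obtain ⟨hqp, rfl⟩ := (mem_filter.1 hq).2
    exact mem_coe.2 (mem_powerset.2 (ones_sdiff_ones_subset hqp))
  · intro U _
    simpa using restrict_le hT U
  · intro q hq
    obtain ⟨hqp, rfl⟩ := (mem_filter.1 hq).2
    exact restrict_free_ones_sdiff_ones hqp
  · intro U hU
    have hU := mem_powerset.1 hU
    have hdisj := (disjoint_ones_free p).mono_right (hU.trans sdiff_subset)
    simp only [ones_restrict hT hU, union_sdiff_cancel_left hdisj]

lemma card_filter_le (p : CubeFace ι) (m : ℕ) :
    #{q ∈ faces ι m | q ≤ p} = (#p.free).choose m * 2 ^ (#p.free - m) := by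
  have hmaps : ∀ q ∈ ({q ∈ faces ι m | q ≤ p} : Finset _), q.free ∈ powersetCard m p.free := by
    intro q hq
    obtain ⟨hq, hqp⟩ := mem_filter.1 hq
    exact mem_powersetCard.2 ⟨free_subset_free hqp, mem_faces.1 hq⟩
  rw [card_eq_sum_card_fiberwise hmaps, ← card_powersetCard, ← smul_eq_mul]
  refine sum_const_nat fun T hT => ?_
  obtain ⟨hTp, rfl⟩ := mem_powersetCard.1 hT
  rw [← card_filter_le_free_eq hTp]
  congr 1
  ext q
  grind [mem_faces]

lemma card_faces (m : ℕ) :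
    #(faces ι m) = (Fintype.card ι).choose m * 2 ^ (Fintype.card ι - m) := by
  simpa using card_filter_le (⊤ : CubeFace ι) m

lemma card_faces_pos {m : ℕ} (hm : m ≤ Fintype.card ι) : 0 < #(faces ι m) := by
  have := Nat.choose_pos hm
  rw [card_faces]
  positivity

-- Both sides count the pairs of a `d`-face and an `m`-face containing it.
lemma card_faces_mul_choose {d m : ℕ} (hdm : d ≤ m) (hm : m ≤ Fintype.card ι) :
    #(faces ι m) * (m.choose d * 2 ^ (m - d))
      = #(faces ι d) * (Fintype.card ι - d).choose (m - d) := by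
  have hpow : 2 ^ (Fintype.card ι - d) = 2 ^ (Fintype.card ι - m) * 2 ^ (m - d) := by
    rw [← pow_add]
    congr 1
    omega
  rw [card_faces, card_faces, hpow]
  linear_combination 2 ^ (Fintype.card ι - m) * 2 ^ (m - d) *
    Nat.choose_mul (n := Fintype.card ι) hdm

lemma mul_card_faces_le_of_forall_le_card {d m t : ℕ} (hdm : d ≤ m) (hm : m ≤ Fintype.card ι)
    {A : Finset (CubeFace ι)} (hA : A ⊆ faces ι d)
    (h : ∀ M ∈ faces ι m, t ≤ #{a ∈ A | a ≤ M}) :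
    t * #(faces ι d) ≤ #A * (m.choose d * 2 ^ (m - d)) := by
  have hincident : #(faces ι m) * t ≤ #A * (Fintype.card ι - d).choose (m - d) := by
    refine card_mul_le_card_mul (fun M a => a ≤ M) h fun a ha => ?_
    obtain rfl := mem_faces.1 (hA ha)
    exact (card_filter_ge a hdm).le
  have hpos : 0 < (Fintype.card ι - d).choose (m - d) := Nat.choose_pos (by omega)
  refine Nat.le_of_mul_le_mul_right ?_ hpos
  calc t * #(faces ι d) * (Fintype.card ι - d).choose (m - d)
      = #(faces ι m) * t * (m.choose d * 2 ^ (m - d)) := by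
        rw [mul_assoc, ← card_faces_mul_choose hdm hm]; ring
    _ ≤ #A * (Fintype.card ι - d).choose (m - d) * (m.choose d * 2 ^ (m - d)) := by gcongr
    _ = #A * (m.choose d * 2 ^ (m - d)) * (Fintype.card ι - d).choose (m - d) := by ring

end Counting

section Blocking

variable {ι : Type*} [Fintype ι] [DecidableEq ι] {E : Finset (CubeFace ι)} {d k l : ℕ}

/-- The `l`-faces that contain a member of `E`. -/
def hit (E : Finset (CubeFace ι)) (l : ℕ) : Finset (CubeFace ι) :=
  {L ∈ faces ι l | ∃ e ∈ E, e ≤ L}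

/-- The family `E` blocks the `k`-faces if every `k`-face contains a member of `E`; deleting a
family of edges from the cube destroys all copies of `Q_k` precisely when it blocks the
`k`-faces. -/
def Blocks (E : Finset (CubeFace ι)) (k : ℕ) : Prop :=
  ∀ K ∈ faces ι k, ∃ e ∈ E, e ≤ K

lemma hit_subset (E : Finset (CubeFace ι)) (l : ℕ) : hit E l ⊆ faces ι l := filter_subset _ _

lemma mem_hit_of_le {e L : CubeFace ι} (he : e ∈ E) (hL : L ∈ faces ι l) (h : e ≤ L) :
    L ∈ hit E l :=
  mem_filter.2 ⟨hL, e, he, h⟩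

lemma card_mul_card_faces_le_card_hit_mul (hdl : d ≤ l) (hl : l ≤ Fintype.card ι)
    (hE : E ⊆ faces ι d) : #E * #(faces ι l) ≤ #(hit E l) * #(faces ι d) := by
  have hincident : #E * (Fintype.card ι - d).choose (l - d)
      ≤ #(hit E l) * (l.choose d * 2 ^ (l - d)) := by
    refine card_mul_le_card_mul (fun e L => e ≤ L) (fun e he => ?_) fun L hL => ?_
    · obtain rfl := mem_faces.1 (hE he)
      rw [← card_filter_ge e hdl]
      refine card_le_card fun L hL => ?_
      obtain ⟨hL, heL⟩ := mem_filter.1 hL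
      exact mem_filter.2 ⟨mem_hit_of_le he hL heL, heL⟩
    · obtain rfl := mem_faces.1 (hit_subset E l hL)
      rw [← card_filter_le]
      exact card_le_card (filter_subset_filter _ hE)
  have hpos : 0 < l.choose d * 2 ^ (l - d) := mul_pos (Nat.choose_pos hdl) (by positivity)
  refine Nat.le_of_mul_le_mul_right ?_ hpos
  calc #E * #(faces ι l) * (l.choose d * 2 ^ (l - d))
      = #E * (Fintype.card ι - d).choose (l - d) * #(faces ι d) := by
        rw [mul_assoc, card_faces_mul_choose hdl hl]; ring
    _ ≤ #(hit E l) * (l.choose d * 2 ^ (l - d)) * #(faces ι d) := by gcongr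
    _ = #(hit E l) * #(faces ι d) * (l.choose d * 2 ^ (l - d)) := by ring

lemma Blocks.choose_mul_card_faces_le (hE : Blocks E k) (hEd : E ⊆ faces ι d) (hdl : d ≤ l)
    (hlk : l ≤ k) (hk : k ≤ Fintype.card ι) :
    (k - d).choose (l - d) * #(faces ι l) ≤ #(hit E l) * (k.choose l * 2 ^ (k - l)) := by
  refine mul_card_faces_le_of_forall_le_card hlk hk (hit_subset E l) fun K hK => ?_
  obtain ⟨e, he, heK⟩ := hE K hK
  obtain rfl := mem_faces.1 (hEd he)
  obtain rfl := mem_faces.1 hK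
  rw [← card_filter_le_and_le heK hdl]
  refine card_le_card fun L hL => ?_
  obtain ⟨hL, heL, hLK⟩ := mem_filter.1 hL
  exact mem_filter.2 ⟨mem_hit_of_le he hL heL, hLK⟩

lemma Blocks.choose_mul_two_pow_mul_card_faces_le (hE : Blocks E k) (hEd : E ⊆ faces ι d)
    (hdl : d ≤ l) (hlk : l ≤ k) (hk : k ≤ Fintype.card ι) :
    l.choose d * 2 ^ l * #(faces ι l) ≤ #(hit E l) * (k.choose d * 2 ^ k) := by
  have hpos : 0 < (k - d).choose (l - d) := Nat.choose_pos (by omega)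
  have hpow : 2 ^ k = 2 ^ (k - l) * 2 ^ l := by rw [← pow_add, Nat.sub_add_cancel hlk]
  refine Nat.le_of_mul_le_mul_right ?_ hpos
  calc l.choose d * 2 ^ l * #(faces ι l) * (k - d).choose (l - d)
      = (k - d).choose (l - d) * #(faces ι l) * (l.choose d * 2 ^ l) := by ring
    _ ≤ #(hit E l) * (k.choose l * 2 ^ (k - l)) * (l.choose d * 2 ^ l) :=
        Nat.mul_le_mul_right _ (hE.choose_mul_card_faces_le hEd hdl hlk hk)
    _ = #(hit E l) * (k.choose l * l.choose d) * (2 ^ (k - l) * 2 ^ l) := by ring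
    _ = #(hit E l) * (k.choose d * 2 ^ k) * (k - d).choose (l - d) := by
        rw [Nat.choose_mul hdl, ← hpow]; ring

-- Two free coordinates `i`, `j` of `M` are told apart by a member of `E` inside the `k`-face of
-- `M` on which `i` is fixed to `true` and `j` to `false`.
lemma Blocks.le_three_pow_card (hE : Blocks E k) {M : CubeFace ι} (hM : M ∈ faces ι (k + 2)) :
    k + 2 ≤ 3 ^ #{e ∈ E | e ≤ M} := by
  have hinj : Function.Injective
      (fun (i : M.free) (e : ({e ∈ E | e ≤ M} : Finset _)) => e.1 i.1) := by
    rintro ⟨i, hi⟩ ⟨j, hj⟩ hij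
    by_contra hne
    replace hne : i ≠ j := fun h => hne (Subtype.ext h)
    set K := M.restrict (M.free \ {i, j}) {i} with hK
    have hKM : K ≤ M := restrict_le sdiff_subset _
    have hKk : K ∈ faces ι k := by
      have hsub : {i, j} ⊆ M.free := insert_subset hi (singleton_subset_iff.2 hj)
      rw [mem_faces, hK, free_restrict, card_sdiff_of_subset hsub, mem_faces.1 hM,
        card_pair hne, Nat.add_sub_cancel]
    obtain ⟨e, he, heK⟩ := hE K hKk
    have heq : e i = e j := congrFun hij ⟨e, mem_filter.2 ⟨he, heK.trans hKM⟩⟩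
    have hi' := heK i
    have hj' := heK j
    grind [restrict_apply, mem_free]
  have hcard := Fintype.card_le_of_injective _ hinj
  rwa [Fintype.card_fun, Fintype.card_coe, Fintype.card_coe, mem_faces.1 hM] at hcard

lemma Blocks.clog_mul_card_faces_le (hE : Blocks E k) (hEd : E ⊆ faces ι d) (hdl : d ≤ l)
    (hl : l ≤ Fintype.card ι) (hdk : d ≤ k + 2) (hk : k + 2 ≤ Fintype.card ι) :
    Nat.clog 3 (k + 2) * #(faces ι l)
      ≤ #(hit E l) * ((k + 2).choose d * 2 ^ (k + 2 - d)) := by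
  have hmany : Nat.clog 3 (k + 2) * #(faces ι d) ≤ #E * ((k + 2).choose d * 2 ^ (k + 2 - d)) :=
    mul_card_faces_le_of_forall_le_card hdk hk hEd fun M hM =>
      Nat.clog_le_of_le_pow (hE.le_three_pow_card hM)
  refine Nat.le_of_mul_le_mul_right ?_ (card_faces_pos (hdl.trans hl))
  calc Nat.clog 3 (k + 2) * #(faces ι l) * #(faces ι d)
      = Nat.clog 3 (k + 2) * #(faces ι d) * #(faces ι l) := by ring
    _ ≤ #E * ((k + 2).choose d * 2 ^ (k + 2 - d)) * #(faces ι l) := Nat.mul_le_mul_right _ hmany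
    _ = #E * #(faces ι l) * ((k + 2).choose d * 2 ^ (k + 2 - d)) := by ring
    _ ≤ #(hit E l) * #(faces ι d) * ((k + 2).choose d * 2 ^ (k + 2 - d)) :=
        Nat.mul_le_mul_right _ (card_mul_card_faces_le_card_hit_mul hdl hl hEd)
    _ = #(hit E l) * ((k + 2).choose d * 2 ^ (k + 2 - d)) * #(faces ι d) := by ring

lemma exists_card_hit_mul_card_le {C : Type*} [Fintype C] [Nonempty C] [DecidableEq C]
    (F : Finset (CubeFace ι)) (χ : CubeFace ι → C) {t : ℕ}
    (h : ∀ L ∈ faces ι l, #(image χ {e ∈ F | e ≤ L}) ≤ t) :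
    ∃ c, #(hit {e ∈ F | χ e = c} l) * Fintype.card C ≤ t * #(faces ι l) := by
  have hsum : ∑ c, #(hit {e ∈ F | χ e = c} l) ≤ #(faces ι l) * t := by
    refine (sum_card_bipartiteAbove_eq_sum_card_bipartiteBelow
      (fun c L => ∃ e ∈ ({e ∈ F | χ e = c} : Finset _), e ≤ L)).trans_le ?_
    refine sum_le_card_nsmul _ _ _ fun L hL => (card_le_card fun c hc => ?_).trans (h L hL)
    obtain ⟨-, e, he, heL⟩ := mem_filter.1 hc
    obtain ⟨heF, hχ⟩ := mem_filter.1 he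
    exact mem_image.2 ⟨e, mem_filter.2 ⟨heF, heL⟩, hχ⟩
  obtain ⟨c, -, hc⟩ := exists_le_of_sum_le (s := (univ : Finset C)) univ_nonempty
    (f := fun c => #(hit {e ∈ F | χ e = c} l) * Fintype.card C) (g := fun _ => t * #(faces ι l))
    (by rw [← sum_mul, sum_const, smul_eq_mul, card_univ, mul_comm, mul_comm t]; gcongr)
  exact ⟨c, hc⟩

end Blocking

section Level

variable {ι : Type*} [Fintype ι]

/-- The colouring of the faces by the number of coordinates fixed to `true`, modulo `a`. -/
def level (a : ℕ) (e : CubeFace ι) : ZMod a := #e.ones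

variable [DecidableEq ι]

lemma card_filter_ones_mem_Icc {e L : CubeFace ι} (h : e ≤ L) (Q : ι → Prop) [DecidablePred Q] :
    #{j ∈ e.ones | Q j}
      ∈ Icc #{j ∈ L.ones | Q j} (#{j ∈ L.ones | Q j} + #{j ∈ L.free \ e.free | Q j}) := by
  have hsplit : #{j ∈ e.ones | Q j}
      = #{j ∈ L.ones | Q j} + #{j ∈ e.ones \ L.ones | Q j} := by
    rw [← card_union_of_disjoint (disjoint_filter_filter disjoint_sdiff), ← filter_union,
      union_sdiff_of_subset (ones_subset_ones h)]
  rw [hsplit, mem_Icc]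
  exact ⟨Nat.le_add_right _ _, Nat.add_le_add_left
    (card_le_card (filter_subset_filter _ (ones_sdiff_ones_subset h))) _⟩

lemma card_filter_ones_restrict {p : CubeFace ι} {T U : Finset ι} (hT : T ⊆ p.free)
    (hU : U ⊆ p.free \ T) (Q : ι → Prop) [DecidablePred Q] :
    #{j ∈ (p.restrict T U).ones | Q j} = #{j ∈ p.ones | Q j} + #{j ∈ U | Q j} := by
  have hdisj := p.disjoint_ones_free.mono_right (hU.trans sdiff_subset)
  rw [ones_restrict hT hU, filter_union,
    card_union_of_disjoint (disjoint_filter_filter hdisj)]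

lemma blocks_filter_level {a d k : ℕ} [NeZero a] (h : a + d ≤ k + 1) (c : ZMod a) :
    Blocks {e ∈ faces ι d | level a e = c} k := by
  intro K hK
  have ha := NeZero.pos a
  obtain ⟨T, hT, hTd⟩ := exists_subset_card_eq (s := K.free) (n := d) (by grind [mem_faces])
  have hcard : a ≤ #(K.free \ T) + 1 := by
    rw [card_sdiff_of_subset hT, mem_faces.1 hK]
    omega
  obtain ⟨U, hU, hUc⟩ := exists_subset_natCast_card_eq hcard (c - #K.ones)
  refine ⟨K.restrict T U, mem_filter.2 ⟨by simpa using hTd, ?_⟩, restrict_le hT U⟩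
  have hones := card_filter_ones_restrict hT hU fun _ => True
  simp only [filter_true] at hones
  rw [level, hones, Nat.cast_add, hUc, add_sub_cancel]

lemma card_image_level_le (a d : ℕ) {l : ℕ} {L : CubeFace ι} (hL : L ∈ faces ι l) :
    #(image (level a) {e ∈ faces ι d | e ≤ L}) ≤ l - d + 1 := by
  have hsub : image (level a) {e ∈ faces ι d | e ≤ L}
      ⊆ (Icc #L.ones (#L.ones + (l - d))).image fun s : ℕ => (s : ZMod a) := by
    refine image_subset_iff.2 fun e he => mem_image.2 ⟨#e.ones, ?_, rfl⟩
    obtain ⟨he, heL⟩ := mem_filter.1 he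
    have hmem := card_filter_ones_mem_Icc heL fun _ => True
    simpa only [filter_true, card_sdiff_of_subset (free_subset_free heL), mem_faces.1 he,
      mem_faces.1 hL] using hmem
  refine (card_le_card hsub).trans (card_image_le.trans ?_)
  rw [Nat.card_Icc]
  omega

end Level

section SideCounts

variable {ι : Type*} [LinearOrder ι] [Fintype ι]

/-- The colouring of the edges by the numbers of coordinates fixed to `true` to the left and to
the right of the free coordinate, modulo `a` and `b`. Quantifying over `e.free` avoids choosing
that coordinate. -/
def sideCounts (a b : ℕ) (e : CubeFace ι) : ZMod a × ZMod b :=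
  (#{j ∈ e.ones | ∀ i ∈ e.free, j < i}, #{j ∈ e.ones | ∀ i ∈ e.free, i < j})

lemma sideCounts_of_free_eq {e : CubeFace ι} {i : ι} (he : e.free = {i}) (a b : ℕ) :
    sideCounts a b e = ((#{j ∈ e.ones | j < i} : ZMod a), (#{j ∈ e.ones | i < j} : ZMod b)) := by
  simp only [sideCounts, he, mem_singleton, forall_eq]

-- The `k`-face has room for all left counts mod `a` and right counts mod `b` at the free
-- coordinate of rank `a - 1`, which has `a - 1` free coordinates before it and `k - a` after it.
lemma blocks_filter_sideCounts {a b k : ℕ} [NeZero a] [NeZero b] (hab : a + b ≤ k + 1)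
    (c : ZMod a × ZMod b) : Blocks {e ∈ faces ι 1 | sideCounts a b e = c} k := by
  intro K hK
  have hk := mem_faces.1 hK
  have ha := NeZero.pos a
  have hb := NeZero.pos b
  obtain ⟨i, hi, hrank : #{j ∈ K.free | j < i} = a - 1⟩ := (bijOn_card_filter_lt K.free).surjOn
    (show a - 1 ∈ range #K.free by rw [mem_range]; omega)
  have hsides := card_filter_lt_add_card_filter_gt hi
  obtain ⟨U, hU, hUc⟩ := exists_subset_natCast_card_eq (a := a) (S := {j ∈ K.free | j < i})
    (by omega) (c.1 - #{j ∈ K.ones | j < i})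
  obtain ⟨V, hV, hVc⟩ := exists_subset_natCast_card_eq (a := b) (S := {j ∈ K.free | i < j})
    (by omega) (c.2 - #{j ∈ K.ones | i < j})
  have hiK : {i} ⊆ K.free := singleton_subset_iff.2 hi
  have hUV : U ∪ V ⊆ K.free \ {i} := by
    intro j
    have := @hU j
    have := @hV j
    grind
  have hleft : ({j ∈ U ∪ V | j < i} : Finset ι) = U := by
    ext j
    have := @hU j
    have := @hV j
    grind
  have hright : ({j ∈ U ∪ V | i < j} : Finset ι) = V := by
    ext j
    have := @hU j
    have := @hV j
    grind
  refine ⟨K.restrict {i} (U ∪ V), mem_filter.2 ⟨by simp, ?_⟩, restrict_le hiK _⟩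
  rw [sideCounts_of_free_eq (free_restrict _ _ _), card_filter_ones_restrict hiK hUV,
    card_filter_ones_restrict hiK hUV, hleft, hright, Nat.cast_add, Nat.cast_add, hUc, hVc,
    add_sub_cancel, add_sub_cancel]

lemma card_image_sideCounts_le (a b : ℕ) {l : ℕ} {L : CubeFace ι} (hL : L ∈ faces ι l) :
    #(image (sideCounts a b) {e ∈ faces ι 1 | e ≤ L}) ≤ (l + 2).choose 3 := by
  let window (Q : ι → Prop) [DecidablePred Q] : Finset ℕ :=
    Icc #{j ∈ L.ones | Q j} (#{j ∈ L.ones | Q j} + #{j ∈ L.free | Q j})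
  let cast : ℕ × ℕ → ZMod a × ZMod b := Prod.map (↑) (↑)
  have hwindow {e : CubeFace ι} (he : e ≤ L) (Q : ι → Prop) [DecidablePred Q] :
      #{j ∈ e.ones | Q j} ∈ window Q :=
    Icc_subset_Icc_right (Nat.add_le_add_left (card_le_card (filter_subset_filter _ sdiff_subset))
      _) (card_filter_ones_mem_Icc he Q)
  have hcard (Q : ι → Prop) [DecidablePred Q] : #(window Q) = #{j ∈ L.free | Q j} + 1 := by
    rw [Nat.card_Icc]
    omega
  have hsub : image (sideCounts a b) {e ∈ faces ι 1 | e ≤ L}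
      ⊆ L.free.biUnion fun i => (window (· < i) ×ˢ window (i < ·)).image cast := by
    refine image_subset_iff.2 fun e he => ?_
    obtain ⟨he, heL⟩ := mem_filter.1 he
    obtain ⟨i, hi⟩ := card_eq_one.1 (mem_faces.1 he)
    have hiL : i ∈ L.free := free_subset_free heL (hi ▸ mem_singleton_self i)
    refine mem_biUnion.2 ⟨i, hiL, mem_image.2 ⟨(_, _), mem_product.2
      ⟨hwindow heL (· < i), hwindow heL (i < ·)⟩, (sideCounts_of_free_eq hi a b).symm⟩⟩
  calc #(image (sideCounts a b) {e ∈ faces ι 1 | e ≤ L})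
      ≤ ∑ i ∈ L.free, #((window (· < i) ×ˢ window (i < ·)).image cast) :=
        (card_le_card hsub).trans card_biUnion_le
    _ ≤ ∑ i ∈ L.free, (#{j ∈ L.free | j < i} + 1) * (#{j ∈ L.free | i < j} + 1) := by
        refine sum_le_sum fun i _ => card_image_le.trans ?_
        rw [card_product, hcard, hcard]
    _ = (l + 2).choose 3 := by
        rw [sum_card_filter_lt_succ_mul_card_filter_gt_succ, mem_faces.1 hL]

end SideCounts

end CubeFace

open Classical in
lemma copyCount_coe {V W : Type*} [Fintype V] {G : SimpleGraph V} (G' : G.Subgraph)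
    [Fintype G'.verts] (T : SimpleGraph W) :
    G'.coe.copyCount T
      = (Finset.univ.filter fun S : G.Subgraph => Nonempty (T ≃g S.coe) ∧ S ≤ G').card := by
  have hiso (S : G'.coe.Subgraph) :
      Nonempty (T ≃g S.coe) ↔ Nonempty (T ≃g (SimpleGraph.Subgraph.coeSubgraph S).coe) :=
    let e := G'.coeCopy.isoSubgraphMap S
    ⟨fun ⟨f⟩ => ⟨f.trans e⟩, fun ⟨f⟩ => ⟨f.trans e.symm⟩⟩
  rw [SimpleGraph.copyCount,
    ← Finset.card_image_of_injective _ (SimpleGraph.Subgraph.coeSubgraph_injective G')]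
  congr 1
  ext S
  simp only [Finset.mem_image, Finset.mem_filter, Finset.mem_univ, true_and]
  refine ⟨?_, fun ⟨hS, hle⟩ => ?_⟩
  · rintro ⟨S, hS, rfl⟩
    exact ⟨(hiso S).1 hS, SimpleGraph.Subgraph.coeSubgraph_le S⟩
  · have hrestrict : SimpleGraph.Subgraph.coeSubgraph (G'.restrict S) = S := by
      rw [SimpleGraph.Subgraph.coeSubgraph_restrict_eq, inf_eq_right.2 hle]
    exact ⟨G'.restrict S, (hiso _).2 (by rwa [hrestrict]), hrestrict⟩

namespace hypercube

/-- The binary sequence obtained from `x` by changing its entry at position `i`. -/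
def flipAt {ι : Type*} [DecidableEq ι] (x : ι → Bool) (i : ι) : ι → Bool :=
  Function.update x i (!x i)

section FlipAt

variable {ι : Type*} [DecidableEq ι]

lemma flipAt_apply (x : ι → Bool) (i j : ι) : flipAt x i j = (x j ^^ decide (j = i)) := by
  by_cases h : j = i
  · subst h
    simp [flipAt]
  · simp [flipAt, h]

@[simp] lemma flipAt_flipAt (x : ι → Bool) (i : ι) : flipAt (flipAt x i) i = x := by
  ext j
  simp [flipAt_apply]

lemma flipAt_comm (x : ι → Bool) (i j : ι) :
    flipAt (flipAt x i) j = flipAt (flipAt x j) i := by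
  ext t
  simp only [flipAt_apply, Bool.xor_right_comm]

lemma flipAt_injective (x : ι → Bool) : Function.Injective (flipAt x) := by
  intro i j h
  by_contra hij
  simpa [flipAt_apply, hij] using congrFun h i

lemma eq_of_flipAt_flipAt_eq {x : ι → Bool} {a b c d : ι}
    (h : flipAt (flipAt x a) b = flipAt (flipAt x c) d) (hab : a ≠ b) (hac : a ≠ c) : d = a := by
  by_contra hda
  simpa [flipAt_apply, hab, hac, Ne.symm hda] using congrFun h a

lemma flipAt_induction [Finite ι] {P : (ι → Bool) → Prop} (zero : P fun _ => false)
    (flipAt : ∀ x i, P x → P (flipAt x i)) (x : ι → Bool) : P x := by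
  have := Fintype.ofFinite ι
  suffices h : ∀ s : Finset ι, P fun i => decide (i ∈ s) by
    simpa using h {i | x i = true}
  intro s
  induction s using Finset.induction_on with
  | empty => simpa using zero
  | insert a s ha ih =>
    convert flipAt _ a ih using 1
    ext j
    rw [flipAt_apply]
    by_cases h : j = a
    · simp [h, ha]
    · simp [h]

end FlipAt

variable {l n : ℕ}

lemma adj_iff_hammingDist_eq_one {x y : Fin n → Bool} :
    (hypercube n).Adj x y ↔ hammingDist x y = 1 := Iff.rfl

lemma adj_iff_exists_eq_flipAt {x y : Fin n → Bool} :
    (hypercube n).Adj x y ↔ ∃ i, y = flipAt x i := by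
  rw [adj_iff_hammingDist_eq_one, hammingDist, Finset.card_eq_one]
  refine exists_congr fun i => ?_
  simp only [Finset.ext_iff, Finset.mem_filter, Finset.mem_univ, true_and, Finset.mem_singleton,
    funext_iff, flipAt_apply]
  refine forall_congr' fun j => ?_
  by_cases hj : j = i <;> cases x j <;> cases y j <;> simp [hj]

lemma adj_flipAt (x : Fin n → Bool) (i : Fin n) : (hypercube n).Adj x (flipAt x i) :=
  adj_iff_exists_eq_flipAt.2 ⟨i, rfl⟩

-- Opposite edges of a 4-cycle are mapped to parallel edges, so the direction of the image of an
-- edge depends only on the direction of the edge.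
lemma exists_direction (f : (hypercube l).Copy (hypercube n)) :
    ∃ σ : Fin l ↪ Fin n, ∀ x i, f (flipAt x i) = flipAt (f x) (σ i) := by
  choose τ hτ using fun x i => adj_iff_exists_eq_flipAt.1 (f.toHom.map_adj (adj_flipAt x i))
  replace hτ : ∀ x i, f (flipAt x i) = flipAt (f x) (τ x i) := hτ
  have hinj (x) : Function.Injective (τ x) := fun i j hij =>
    flipAt_injective x (f.injective ((hτ x i).trans (hij ▸ (hτ x j).symm)))
  have hne (x i j) (hij : i ≠ j) : τ x i ≠ τ (flipAt x i) j := fun h => by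
    have hback : f (flipAt (flipAt x i) j) = f x := by rw [hτ, hτ, h, flipAt_flipAt]
    refine hij (flipAt_injective (flipAt x i) ?_)
    rw [flipAt_flipAt, f.injective hback]
  have hpar (x i j) : τ (flipAt x j) i = τ x i := by
    rcases eq_or_ne i j with rfl | hij
    · have hself := hτ (flipAt x i) i
      rw [flipAt_flipAt, hτ x i] at hself
      exact flipAt_injective (flipAt (f x) (τ x i)) (by rw [← hself, flipAt_flipAt])
    · refine eq_of_flipAt_flipAt_eq (x := f x) ?_ (hne x i j hij) ((hinj x).ne hij)
      rw [← hτ, ← hτ, ← hτ, ← hτ, flipAt_comm]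
  have hconst (x) : τ x = τ fun _ => false := by
    induction x using flipAt_induction with
    | zero => rfl
    | flipAt x i ih => rw [← ih, funext fun j => hpar x j i]
  exact ⟨⟨_, hinj fun _ => false⟩, fun x i => by rw [hτ, hconst]; rfl⟩

/-- The standard map of `Q_l` into `Q_n` that sends the origin to `b` and the `i`-th direction to
the direction `σ i`. -/
noncomputable def cubeMap (σ : Fin l ↪ Fin n) (b : Fin n → Bool) (x : Fin l → Bool) :
    Fin n → Bool :=
  fun j => b j ^^ Function.extend σ x (fun _ => false) j

variable (σ : Fin l ↪ Fin n) (b : Fin n → Bool)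

lemma cubeMap_apply (x : Fin l → Bool) (i : Fin l) : cubeMap σ b x (σ i) = (b (σ i) ^^ x i) := by
  rw [cubeMap, σ.injective.extend_apply]

lemma cubeMap_apply_of_notMem_range (x : Fin l → Bool) {j : Fin n} (hj : j ∉ Set.range σ) :
    cubeMap σ b x j = b j := by
  rw [cubeMap, Function.extend_apply' _ _ _ hj, Bool.xor_false]

lemma cubeMap_zero : cubeMap σ b (fun _ => false) = b := by
  ext j
  by_cases hj : j ∈ Set.range σ
  · obtain ⟨i, rfl⟩ := hj
    rw [cubeMap_apply, Bool.xor_false]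
  · rw [cubeMap_apply_of_notMem_range σ b _ hj]

lemma cubeMap_flipAt (x : Fin l → Bool) (i : Fin l) :
    cubeMap σ b (flipAt x i) = flipAt (cubeMap σ b x) (σ i) := by
  ext j
  by_cases hj : j ∈ Set.range σ
  · obtain ⟨t, rfl⟩ := hj
    simp [flipAt_apply, cubeMap_apply]
  · have hji : j ≠ σ i := fun h => hj ⟨i, h.symm⟩
    simp [flipAt_apply, cubeMap_apply_of_notMem_range σ b _ hj, hji]

lemma hammingDist_cubeMap (x y : Fin l → Bool) :
    hammingDist (cubeMap σ b x) (cubeMap σ b y) = hammingDist x y := by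
  rw [hammingDist, hammingDist, ← Finset.card_map σ]
  congr 1
  ext j
  by_cases hj : j ∈ Set.range σ
  · obtain ⟨i, rfl⟩ := hj
    simp [cubeMap_apply]
  · have hσ : ∀ i, σ i ≠ j := fun i h => hj ⟨i, h⟩
    simp [cubeMap_apply_of_notMem_range σ b _ hj, hσ]

/-- The standard map `cubeMap σ b` as a graph embedding. -/
noncomputable def cubeEmbedding : hypercube l ↪g hypercube n where
  toFun := cubeMap σ b
  inj' x y h := by
    rw [← hammingDist_eq_zero, ← hammingDist_cubeMap σ b, h, hammingDist_self]
  map_rel_iff' := by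
    intro x y
    exact (hammingDist_cubeMap σ b x y).congr_left

lemma exists_eq_toCopy_cubeEmbedding (f : (hypercube l).Copy (hypercube n)) :
    ∃ σ b, f = (cubeEmbedding σ b).toCopy := by
  obtain ⟨σ, hσ⟩ := exists_direction f
  refine ⟨σ, f fun _ => false, DFunLike.ext _ _ fun x => ?_⟩
  change f x = cubeMap σ (f fun _ => false) x
  induction x using flipAt_induction with
  | zero => rw [cubeMap_zero]
  | flipAt x i ih => rw [hσ, ih, cubeMap_flipAt]

end hypercube

namespace CubeFace

open Finset

section Vertex

variable {ι : Type*} {p : CubeFace ι} {x y : ι → Bool}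

/-- A binary sequence as a face of dimension `0`. -/
def vertex (x : ι → Bool) : CubeFace ι := ⟨fun i => some (x i)⟩

@[simp] lemma vertex_apply (x : ι → Bool) (i : ι) : vertex x i = some (x i) := rfl

/-- The vertex of a face all of whose free coordinates have the value `b`. -/
def point (p : CubeFace ι) (b : Bool) : ι → Bool := fun i => (p i).getD b

lemma vertex_point_le (p : CubeFace ι) (b : Bool) : vertex (p.point b) ≤ p := fun i => by
  rcases h : p i with _ | c <;> simp [point, h]

lemma vertex_point_sup_vertex_point (p : CubeFace ι) :
    vertex (p.point false) ⊔ vertex (p.point true) = p := by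
  ext1 i
  rcases h : p i with _ | c <;> simp [sup_apply, point, h]

lemma vertex_le_release_vertex [DecidableEq ι] {T : Finset ι} :
    vertex y ≤ (vertex x).release T ↔ ∀ i ∉ T, y i = x i := by
  simp only [le_iff, release_apply, vertex_apply]
  grind

variable [Fintype ι]

lemma free_vertex (x : ι → Bool) : (vertex x).free = ∅ := by
  ext i
  simp

lemma card_free_vertex_sup_vertex (x y : ι → Bool) :
    #(vertex x ⊔ vertex y).free = hammingDist x y := by
  rw [hammingDist]
  congr 1
  ext i
  simp [sup_apply]

lemma vertex_flipAt_le [DecidableEq ι] (hx : vertex x ≤ p) {i : ι} (hi : i ∈ p.free) :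
    vertex (hypercube.flipAt x i) ≤ p := fun j => by
  by_cases hj : j = i
  · exact Or.inl (hj ▸ mem_free.1 hi)
  · simpa [hypercube.flipAt_apply, hj] using hx j

end Vertex

variable {l n : ℕ} {p q e : CubeFace (Fin n)} {x y : Fin n → Bool}

lemma vertex_sup_vertex_mem_faces_one :
    vertex x ⊔ vertex y ∈ faces (Fin n) 1 ↔ (hypercube n).Adj x y := by
  rw [mem_faces, card_free_vertex_sup_vertex, hypercube.adj_iff_hammingDist_eq_one]

lemma adj_point_false_point_true (he : e ∈ faces (Fin n) 1) :
    (hypercube n).Adj (e.point false) (e.point true) := by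
  rwa [← vertex_sup_vertex_mem_faces_one, vertex_point_sup_vertex_point]

/-- The subgraph of the hypercube induced on the vertices of a face. -/
def subcube (p : CubeFace (Fin n)) : (hypercube n).Subgraph :=
  (⊤ : (hypercube n).Subgraph).induce {x | vertex x ≤ p}

lemma subcube_adj :
    p.subcube.Adj x y ↔ vertex x ≤ p ∧ vertex y ≤ p ∧ (hypercube n).Adj x y := by
  simp [subcube]

lemma subcube_le_subcube : q.subcube ≤ p.subcube ↔ q ≤ p := by
  refine ⟨fun h => ?_, fun h => ⟨fun x hx => le_trans hx h, fun x y => ?_⟩⟩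
  · rw [← q.vertex_point_sup_vertex_point]
    exact sup_le (h.1 (q.vertex_point_le _)) (h.1 (q.vertex_point_le _))
  · rw [subcube_adj, subcube_adj]
    exact fun ⟨hx, hy, hxy⟩ => ⟨hx.trans h, hy.trans h, hxy⟩

lemma subcube_injective : Function.Injective (subcube (n := n)) := fun _ _ h =>
  le_antisymm (subcube_le_subcube.1 h.le) (subcube_le_subcube.1 h.ge)

lemma subcube_le_iff_forall_edge {G : (hypercube n).Subgraph} (hp : p.free.Nonempty) :
    p.subcube ≤ G ↔ ∀ e ∈ faces (Fin n) 1, e ≤ p → e.subcube ≤ G := by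
  refine ⟨fun h e _ hep => (subcube_le_subcube.2 hep).trans h, fun h => ?_⟩
  have hadj {x y : Fin n → Bool} (hxy : p.subcube.Adj x y) : G.Adj x y := by
    obtain ⟨hx, hy, hxy⟩ := subcube_adj.1 hxy
    exact (h _ (vertex_sup_vertex_mem_faces_one.2 hxy) (sup_le hx hy)).2
      (subcube_adj.2 ⟨le_sup_left, le_sup_right, hxy⟩)
  obtain ⟨i, hi⟩ := hp
  exact ⟨fun x hx => G.edge_vert (hadj (subcube_adj.2
    ⟨hx, vertex_flipAt_le hx hi, hypercube.adj_flipAt x i⟩)), fun _ _ => hadj⟩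

open hypercube in
lemma range_cubeMap (σ : Fin l ↪ Fin n) (b : Fin n → Bool) :
    Set.range (cubeMap σ b) = {y | vertex y ≤ (vertex b).release (univ.map σ)} := by
  ext y
  rw [Set.mem_ofPred_eq, vertex_le_release_vertex]
  constructor
  · rintro ⟨x, rfl⟩ j hj
    exact cubeMap_apply_of_notMem_range σ b x (by simpa using hj)
  · refine fun hy => ⟨fun i => b (σ i) ^^ y (σ i), funext fun j => ?_⟩
    by_cases hj : j ∈ Set.range σ
    · obtain ⟨i, rfl⟩ := hj
      rw [cubeMap_apply, ← Bool.xor_assoc, Bool.xor_self, Bool.false_xor]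
    · rw [cubeMap_apply_of_notMem_range σ b _ hj, hy j (by simpa using hj)]

open hypercube in
lemma toSubgraph_toCopy_cubeEmbedding (σ : Fin l ↪ Fin n) (b : Fin n → Bool) :
    (cubeEmbedding σ b).toCopy.toSubgraph
      = subcube ((vertex b).release (univ.map σ)) := by
  have hmem (y) : vertex y ≤ (vertex b).release (univ.map σ) ↔ ∃ x, cubeMap σ b x = y :=
    (Set.ext_iff.1 (range_cubeMap σ b) y).symm
  refine SimpleGraph.Subgraph.ext ?_ ?_
  · rw [SimpleGraph.Copy.toSubgraph, SimpleGraph.Subgraph.map_verts,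
      SimpleGraph.Subgraph.verts_top, Set.image_univ]
    exact range_cubeMap σ b
  · ext y z
    rw [subcube_adj, hmem, hmem]
    constructor
    · rintro ⟨x, x', hadj, rfl, rfl⟩
      exact ⟨⟨x, rfl⟩, ⟨x', rfl⟩, (cubeEmbedding σ b).map_adj_iff.2 hadj⟩
    · rintro ⟨⟨x, rfl⟩, ⟨x', rfl⟩, hadj⟩
      exact ⟨x, x', (cubeEmbedding σ b).map_adj_iff.1 hadj, rfl, rfl⟩

lemma nonempty_iso_coe_iff {S : (hypercube n).Subgraph} :
    Nonempty (hypercube l ≃g S.coe) ↔ ∃ p ∈ faces (Fin n) l, p.subcube = S := by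
  have hcopy : Nonempty (hypercube l ≃g S.coe)
      ↔ ∃ f : (hypercube l).Copy (hypercube n), f.toSubgraph = S :=
    (Set.ext_iff.1 SimpleGraph.Copy.range_toSubgraph S).symm
  rw [hcopy]
  constructor
  · rintro ⟨f, rfl⟩
    obtain ⟨σ, b, rfl⟩ := hypercube.exists_eq_toCopy_cubeEmbedding f
    refine ⟨_, ?_, (toSubgraph_toCopy_cubeEmbedding σ b).symm⟩
    rw [mem_faces, free_release, free_vertex, union_empty, card_map, card_univ, Fintype.card_fin]
  · rintro ⟨p, hp, rfl⟩
    let σ := (p.free.orderEmbOfFin (mem_faces.1 hp)).toEmbedding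
    refine ⟨(hypercube.cubeEmbedding σ (p.point false)).toCopy, ?_⟩
    have hfree : univ.map σ = p.free \ (vertex (p.point false)).free := by
      rw [free_vertex, sdiff_empty]
      exact map_orderEmbOfFin_univ _ _
    rw [toSubgraph_toCopy_cubeEmbedding, hfree, release_free_sdiff_free (p.vertex_point_le _)]

lemma copyCount_hypercube (n l : ℕ) :
    (hypercube n).copyCount (hypercube l) = #(faces (Fin n) l) := by
  classical
  rw [SimpleGraph.copyCount, ← card_image_of_injective _ subcube_injective]
  congr 1
  ext S
  simp only [mem_filter, mem_univ, true_and, mem_image, nonempty_iso_coe_iff]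

end CubeFace

namespace CubeFace

open Finset

variable {k l n : ℕ} {p e : CubeFace (Fin n)} {G : (hypercube n).Subgraph}

/-- The edges of the hypercube that are not in the subgraph `G`, as faces of dimension `1`. -/
noncomputable def missing (G : (hypercube n).Subgraph) : Finset (CubeFace (Fin n)) := by
  classical exact {e ∈ faces (Fin n) 1 | ¬ e.subcube ≤ G}

lemma mem_missing : e ∈ missing G ↔ e ∈ faces (Fin n) 1 ∧ ¬ e.subcube ≤ G := by
  classical
  rw [missing, mem_filter]

lemma missing_subset (G : (hypercube n).Subgraph) : missing G ⊆ faces (Fin n) 1 :=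
  fun _ he => (mem_missing.1 he).1

lemma subcube_le_iff_notMem_hit (hl : 0 < l) (hp : p ∈ faces (Fin n) l) :
    p.subcube ≤ G ↔ p ∉ hit (missing G) l := by
  have hfree : p.free.Nonempty := card_pos.1 (by rwa [mem_faces.1 hp])
  rw [subcube_le_iff_forall_edge hfree, hit, mem_filter]
  grind [mem_missing]

lemma copyCount_coe_add_card_hit (hl : 0 < l) (G : (hypercube n).Subgraph) [Fintype G.verts] :
    G.coe.copyCount (hypercube l) + #(hit (missing G) l) = #(faces (Fin n) l) := by
  classical
  have hcopies : G.coe.copyCount (hypercube l) = #(faces (Fin n) l \ hit (missing G) l) := by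
    rw [copyCount_coe, ← card_image_of_injective _ subcube_injective]
    congr 1
    ext S
    simp only [mem_filter, mem_univ, true_and, mem_image, nonempty_iso_coe_iff, mem_sdiff]
    constructor
    · rintro ⟨⟨p, hp, rfl⟩, hle⟩
      exact ⟨p, ⟨hp, (subcube_le_iff_notMem_hit hl hp).1 hle⟩, rfl⟩
    · rintro ⟨p, ⟨hp, hmiss⟩, rfl⟩
      exact ⟨⟨p, hp, rfl⟩, (subcube_le_iff_notMem_hit hl hp).2 hmiss⟩
  rw [hcopies, card_sdiff_add_card_eq_card (hit_subset _ _)]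

lemma free_iff_blocks_missing (hk : 0 < k) :
    (hypercube k).Free G.coe ↔ Blocks (missing G) k := by
  classical
  rw [← SimpleGraph.copyCount_eq_zero, Blocks, ← filter_eq_self, ← hit]
  have hadd := copyCount_coe_add_card_hit hk G
  refine ⟨fun h => eq_of_subset_of_card_le (hit_subset _ _) (by omega), fun h => ?_⟩
  rw [h] at hadd
  omega

/-- The spanning subgraph of the hypercube obtained by deleting the edges in `E`. -/
def deleteFaces (E : Finset (CubeFace (Fin n))) : (hypercube n).Subgraph where
  verts := Set.univ
  Adj x y := (hypercube n).Adj x y ∧ vertex x ⊔ vertex y ∉ E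
  adj_sub h := h.1
  edge_vert _ := trivial
  symm := ⟨fun _ _ h => ⟨h.1.symm, sup_comm (vertex _) (vertex _) ▸ h.2⟩⟩

lemma subcube_le_deleteFaces_iff {E : Finset (CubeFace (Fin n))} (he : e ∈ faces (Fin n) 1) :
    e.subcube ≤ deleteFaces E ↔ e ∉ E := by
  constructor
  · intro h
    have hdel := h.2 (subcube_adj.2
      ⟨e.vertex_point_le false, e.vertex_point_le true, adj_point_false_point_true he⟩)
    simpa only [vertex_point_sup_vertex_point] using hdel.2
  · refine fun heE => ⟨fun _ _ => trivial, fun x y hxy => ?_⟩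
    obtain ⟨hx, hy, hxy⟩ := subcube_adj.1 hxy
    have hsup : vertex x ⊔ vertex y = e := eq_of_le_of_card_free_le (sup_le hx hy)
      (by rw [mem_faces.1 he, mem_faces.1 (vertex_sup_vertex_mem_faces_one.2 hxy)])
    exact ⟨hxy, hsup ▸ heE⟩

lemma missing_deleteFaces {E : Finset (CubeFace (Fin n))} (hE : E ⊆ faces (Fin n) 1) :
    missing (deleteFaces E) = E := by
  ext e
  rw [mem_missing]
  refine ⟨fun ⟨he, h⟩ => ?_, fun he => ⟨hE he, fun h => ?_⟩⟩
  · simpa only [subcube_le_deleteFaces_iff he, not_not] using h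
  · exact (subcube_le_deleteFaces_iff (hE he)).1 h he

end CubeFace

section GenExtremal

variable {V W U : Type*} [Fintype V] {G : SimpleGraph V} {T : SimpleGraph W} {H : SimpleGraph U}

lemma copyCount_le_genExtremal {G' : G.Subgraph} [Fintype G'.verts] (h : H.Free G'.coe) :
    G'.coe.copyCount T ≤ genExtremal G T H := by
  classical
  refine le_trans (Eq.le ?_) (Finset.le_sup (Finset.mem_filter.2 ⟨Finset.mem_univ G', h⟩))
  congr!

lemma genExtremal_le {N : ℕ}
    (h : ∀ (G' : G.Subgraph) [Fintype G'.verts], H.Free G'.coe → G'.coe.copyCount T ≤ N) :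
    genExtremal G T H ≤ N := by
  classical
  exact Finset.sup_le fun G' hG' => h G' (Finset.mem_filter.1 hG').2

end GenExtremal

lemma exists_add_eq_succ_and_mul_le {k : ℕ} (hk : 0 < k) :
    ∃ a b, 0 < a ∧ 0 < b ∧ a + b = k + 1 ∧ k * (k + 2) ≤ 4 * (a * b) := by
  rcases Nat.even_or_odd' k with ⟨m, rfl | rfl⟩
  · exact ⟨m, m + 1, by omega, by omega, by omega, by nlinarith⟩
  · exact ⟨m + 1, m + 1, by omega, by omega, by omega, by nlinarith⟩

lemma log_le_two_mul_clog_three (k : ℕ) : Real.log k ≤ 2 * Nat.clog 3 (k + 2) := by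
  have hthree : Real.log 3 ≤ 2 := Real.log_three_lt_d9.le.trans (by norm_num)
  calc Real.log k = Real.logb 3 k * Real.log 3 := by
        rw [← Real.log_div_log, div_mul_cancel₀ _ (Real.log_pos (by norm_num)).ne']
    _ ≤ ⌈Real.logb (3 : ℕ) k⌉₊ * 2 := by
        gcongr
        exact Nat.le_ceil _
    _ ≤ 2 * Nat.clog 3 (k + 2) := by
        rw [Real.natCeil_logb_natCast, mul_comm]
        exact_mod_cast Nat.mul_le_mul_left 2 (Nat.clog_mono_right 3 (Nat.le_add_right k 2))

namespace CubeFace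

open Finset

variable {k l n : ℕ}

lemma one_sub_card_hit_div_le_genTuranDensity (hk : 0 < k) (hl : 0 < l) (hln : l ≤ n)
    {E : Finset (CubeFace (Fin n))} (hE : E ⊆ faces (Fin n) 1) (hblocks : Blocks E k) :
    1 - (#(hit E l) : ℝ) / #(faces (Fin n) l)
      ≤ genTuranDensity (hypercube n) (hypercube l) (hypercube k) := by
  classical
  have hfree : (hypercube k).Free (deleteFaces E).coe := by
    rwa [free_iff_blocks_missing hk, missing_deleteFaces hE]
  have hle : (deleteFaces E).coe.copyCount (hypercube l)
      ≤ genExtremal (hypercube n) (hypercube l) (hypercube k) := copyCount_le_genExtremal hfree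
  have hadd := copyCount_coe_add_card_hit hl (deleteFaces E)
  rw [missing_deleteFaces hE] at hadd
  have hpos : 0 < #(faces (Fin n) l) := card_faces_pos (by rwa [Fintype.card_fin])
  rw [genTuranDensity, copyCount_hypercube, one_sub_div (by positivity)]
  gcongr
  rw [sub_le_iff_le_add]
  exact_mod_cast hadd.symm.le.trans (Nat.add_le_add_right hle _)

lemma one_sub_div_card_le_genTuranDensity (hk : 0 < k) (hl : 0 < l) (hln : l ≤ n)
    {C : Type*} [Fintype C] [Nonempty C] [DecidableEq C] (χ : CubeFace (Fin n) → C) {t : ℕ}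
    (hblocks : ∀ c, Blocks {e ∈ faces (Fin n) 1 | χ e = c} k)
    (himage : ∀ L ∈ faces (Fin n) l, #(image χ {e ∈ faces (Fin n) 1 | e ≤ L}) ≤ t) :
    1 - (t : ℝ) / Fintype.card C
      ≤ genTuranDensity (hypercube n) (hypercube l) (hypercube k) := by
  obtain ⟨c, hc⟩ := exists_card_hit_mul_card_le (faces (Fin n) 1) χ himage
  refine le_trans (sub_le_sub_left ?_ 1)
    (one_sub_card_hit_div_le_genTuranDensity hk hl hln (filter_subset _ _) (hblocks c))
  have hpos : 0 < #(faces (Fin n) l) := card_faces_pos (by rwa [Fintype.card_fin])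
  rw [div_le_div_iff₀ (by positivity) (by positivity)]
  exact_mod_cast hc

lemma genTuranDensity_le_one_sub (hk : 0 < k) (hl : 0 < l) (hln : l ≤ n) {δ : ℝ} (hδ : δ ≤ 1)
    (h : ∀ E ⊆ faces (Fin n) 1, Blocks E k → δ * #(faces (Fin n) l) ≤ #(hit E l)) :
    genTuranDensity (hypercube n) (hypercube l) (hypercube k) ≤ 1 - δ := by
  have hpos : 0 < #(faces (Fin n) l) := card_faces_pos (by rwa [Fintype.card_fin])
  rw [genTuranDensity, copyCount_hypercube, div_le_iff₀ (by positivity)]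
  suffices hfloor : genExtremal (hypercube n) (hypercube l) (hypercube k)
      ≤ ⌊(1 - δ) * #(faces (Fin n) l)⌋₊ from
    (Nat.cast_le.2 hfloor).trans
      (Nat.floor_le (mul_nonneg (sub_nonneg.2 hδ) (Nat.cast_nonneg _)))
  refine genExtremal_le fun G _ hG => Nat.le_floor ?_
  have hhit := h _ (missing_subset G) ((free_iff_blocks_missing hk).1 hG)
  have hadd : (G.coe.copyCount (hypercube l) : ℝ) + #(hit (missing G) l) = #(faces (Fin n) l) := by
    exact_mod_cast copyCount_coe_add_card_hit hl G
  linarith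

lemma one_sub_div_le_genTuranDensity (hk : 0 < k) (hl : 0 < l) (hln : l ≤ n) :
    1 - (l : ℝ) / k ≤ genTuranDensity (hypercube n) (hypercube l) (hypercube k) := by
  have : NeZero k := ⟨hk.ne'⟩
  have hbound := one_sub_div_card_le_genTuranDensity hk hl hln (level k)
    (blocks_filter_level le_rfl) fun _ => card_image_level_le k 1
  rwa [ZMod.card, Nat.sub_add_cancel hl] at hbound

lemma one_sub_choose_div_le_genTuranDensity (hk : 0 < k) (hl : 0 < l) (hln : l ≤ n) :
    1 - 4 * ((l + 2).choose 3 : ℝ) / (k * (k + 2))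
      ≤ genTuranDensity (hypercube n) (hypercube l) (hypercube k) := by
  obtain ⟨a, b, ha, hb, hab, hprod⟩ := exists_add_eq_succ_and_mul_le hk
  have : NeZero a := ⟨ha.ne'⟩
  have : NeZero b := ⟨hb.ne'⟩
  have hbound := one_sub_div_card_le_genTuranDensity hk hl hln (sideCounts a b)
    (blocks_filter_sideCounts hab.le) fun _ => card_image_sideCounts_le a b
  rw [Fintype.card_prod, ZMod.card, ZMod.card] at hbound
  refine le_trans (sub_le_sub_left ?_ 1) hbound
  have hprod' : (k * (k + 2) : ℝ) ≤ 4 * (a * b : ℕ) := by exact_mod_cast hprod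
  calc ((l + 2).choose 3 : ℝ) / (a * b : ℕ) = 4 * (l + 2).choose 3 / (4 * (a * b : ℕ)) :=
        (mul_div_mul_left _ _ four_ne_zero).symm
    _ ≤ 4 * (l + 2).choose 3 / (k * (k + 2)) := by gcongr

lemma genTuranDensity_le_one_sub_div (hl : 0 < l) (hlk : l ≤ k) (hkn : k ≤ n) :
    genTuranDensity (hypercube n) (hypercube l) (hypercube k)
      ≤ 1 - (l : ℝ) * 2 ^ l / (k * 2 ^ k) := by
  have hk : 0 < k := by omega
  refine genTuranDensity_le_one_sub hk hl (hlk.trans hkn) ?_ fun E hE hblocks => ?_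
  · rw [div_le_one (by positivity)]
    exact_mod_cast Nat.mul_le_mul hlk (Nat.pow_le_pow_right two_pos hlk)
  · have hhit := hblocks.choose_mul_two_pow_mul_card_faces_le hE hl hlk (by rwa [Fintype.card_fin])
    rw [Nat.choose_one_right, Nat.choose_one_right] at hhit
    rw [div_mul_eq_mul_div, div_le_iff₀ (by positivity)]
    exact_mod_cast hhit

-- In `1 / 12`, a factor `2` is lost to `log 3 ≤ 2`, another `2` to the passage from `2 ^ (k + 1)`
-- to `2 ^ k`, and a factor `3` to `k + 2 ≤ 3 * k`.
lemma genTuranDensity_le_one_sub_log_div (hk : 0 < k) (hl : 0 < l) (hln : l ≤ n)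
    (hkn : k + 2 ≤ n) :
    genTuranDensity (hypercube n) (hypercube l) (hypercube k)
      ≤ 1 - 1 / 12 * Real.log k / (k * 2 ^ k) := by
  have hk1 : (1 : ℝ) ≤ k := by exact_mod_cast hk
  refine genTuranDensity_le_one_sub hk hl hln ?_ fun E hE hblocks => ?_
  · have hlog := Real.log_le_self k.cast_nonneg
    have hpow : (1 : ℝ) ≤ 2 ^ k := one_le_pow₀ one_le_two
    rw [div_le_one (by positivity)]
    nlinarith
  · have hhit := hblocks.clog_mul_card_faces_le hE hl (by rwa [Fintype.card_fin]) (by omega)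
      (by rwa [Fintype.card_fin])
    rw [Nat.choose_one_right, show k + 2 - 1 = k + 1 by omega] at hhit
    have hhit' : (Nat.clog 3 (k + 2) : ℝ) * #(faces (Fin n) l)
        ≤ #(hit E l) * ((k + 2) * 2 ^ (k + 1)) := by exact_mod_cast hhit
    rw [div_mul_eq_mul_div, div_le_iff₀ (by positivity)]
    calc 1 / 12 * Real.log k * #(faces (Fin n) l)
        ≤ 1 / 12 * (2 * Nat.clog 3 (k + 2)) * #(faces (Fin n) l) := by
          gcongr
          exact log_le_two_mul_clog_three k
      _ = 1 / 6 * (Nat.clog 3 (k + 2) * #(faces (Fin n) l)) := by ring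
      _ ≤ 1 / 6 * (#(hit E l) * ((k + 2) * 2 ^ (k + 1))) := by gcongr
      _ = #(hit E l) * ((k + 2) / 3 * 2 ^ k) := by ring
      _ ≤ #(hit E l) * (k * 2 ^ k) := by
          gcongr
          linarith

end CubeFace

theorem theorem1_general {k ℓ n : ℕ} (hℓ : 0 < ℓ) (hℓk : ℓ ≤ k) (hn : k + 2 ≤ n) :
    max (1 - (ℓ : ℝ) / (k : ℝ))
        (1 - 4 * ((ℓ + 2).choose 3 : ℝ) / ((k : ℝ) * ((k : ℝ) + 2)))
      ≤ genTuranDensity (hypercube n) (hypercube ℓ) (hypercube k) ∧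
    genTuranDensity (hypercube n) (hypercube ℓ) (hypercube k)
      ≤ min (1 - (ℓ : ℝ) * 2 ^ ℓ / ((k : ℝ) * 2 ^ k))
            (1 - 1 / 12 * Real.log (k : ℝ) / ((k : ℝ) * 2 ^ k)) := by
  have hk : 0 < k := hℓ.trans_le hℓk
  have hkn : k ≤ n := (Nat.le_add_right k 2).trans hn
  have hℓn : ℓ ≤ n := hℓk.trans hkn
  constructor
  · exact max_le (CubeFace.one_sub_div_le_genTuranDensity hk hℓ hℓn)
      (CubeFace.one_sub_choose_div_le_genTuranDensity hk hℓ hℓn)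
  · exact le_min (CubeFace.genTuranDensity_le_one_sub_div hℓ hℓk hkn)
      (CubeFace.genTuranDensity_le_one_sub_log_div hk hℓ hℓn hn)

theorem theorem1 :
    ∃ α : ℝ, 0 < α ∧ ∀ k ℓ : ℕ, 2 ≤ ℓ → ℓ < k → ∃ n₀ : ℕ, ∀ n : ℕ, n₀ ≤ n →
      max (1 - (ℓ : ℝ) / (k : ℝ))
          (1 - 4 * ((ℓ + 2).choose 3 : ℝ) / ((k : ℝ) * ((k : ℝ) + 2)))
        ≤ genTuranDensity (hypercube n) (hypercube ℓ) (hypercube k) ∧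
      genTuranDensity (hypercube n) (hypercube ℓ) (hypercube k)
        ≤ min (1 - (ℓ : ℝ) * 2 ^ ℓ / ((k : ℝ) * 2 ^ k))
              (1 - α * Real.log (k : ℝ) / ((k : ℝ) * 2 ^ k)) := by
  exact ⟨1 / 12, by norm_num, fun k ℓ hℓ hℓk => ⟨k + 2, fun n hn =>
    theorem1_general (by omega) hℓk.le hn⟩⟩
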